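/- Let $n\ge 3$ and let $M\subseteq\mathbb R^n$ be a symmetric domain: an open ball centred at $0$, an annulus $\{\nu_2\le |x|<\nu_1\}$ or $\{\nu_2<|x|<\nu_1\}$ with $0\le\nu_2<\nu_1$, the whole space $\mathbb R^n$, or $\mathbb R^n\setminus\{0\}$. Let $F$ be a Finsler metric on $M$ which is spherically symmetric, i.e. of the form $$F(x,y)=|y|\,\phi(r,s),\qquad r=|x|,\quad s=\frac{\langle x,y\rangle}{|y|}\qquad (x\in M,\ y\neq 0),$$ with $\phi=\phi(r,s)$ smooth for $r>0$. Assume that $F$ is a Douglas metric (its Douglas curvature $D_j{}^i{}_{kl}=\frac{\partial^3}{\partial y^j\partial y^k\partial y^l}\bigl(G^i-\frac1{n+1}\sum_m\frac{\partial G^m}{\partial y^m}y^i\bigr)$ vanishes, $G^i$ being the geodesic coefficients of $F$) and that $F$ has constant flag curvature $K$. Put $$Q=\frac1{2r}\,\frac{r\phi_{ss}-\phi_r+s\phi_{rs}}{\phi-s\phi_s+(r^2-s^2)\phi_{ss}},\qquad P=\frac{r\phi_s+s\phi_r}{2r\phi}-\frac Q\phi\bigl[s\phi+(r^2-s^2)\phi_s\bigr],$$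 $$R_1=P^2-\frac1r\,(sP_r+rP_s)+2Q\bigl[1+sP+(r^2-s^2)P_s\bigr].$$ Then $$K=\frac{R_1}{\phi^2}$$ at $(r,s)=\bigl(|x|,\langle x,y\rangle/|y|\bigr)$ for all $x\in M\setminus\{0\}$ and all $y\in\mathbb R^n\setminus\{0\}$. -/

import Mathlib

namespace SphFinsler

noncomputable section

/-- The standard Euclidean space `ℝⁿ`. -/
abbrev E (n : ℕ) : Type := EuclideanSpace ℝ (Fin n)

/-- The symmetric subsets of `ℝⁿ` on which the metrics live: an open ball centred at the origin,
an annulus with inner radius `ν₂ ≥ 0` (with or without its inner boundary sphere; for `ν₂ = 0` the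
second form is the punctured ball), the whole space, or the punctured space. -/
def IsSymmetricDomain {n : ℕ} (M : Set (E n)) : Prop :=
  (∃ ν : ℝ, 0 < ν ∧ M = Metric.ball 0 ν) ∨
  (∃ ν₁ ν₂ : ℝ, 0 ≤ ν₂ ∧ ν₂ < ν₁ ∧
    (M = Metric.ball 0 ν₁ \ Metric.ball 0 ν₂ ∨ M = Metric.ball 0 ν₁ \ Metric.closedBall 0 ν₂)) ∨
  M = Set.univ ∨ M = Set.univ \ {0}

/-- The partial derivative `∂f/∂zⁱ` at the point `z`. -/
def pd {n : ℕ} (i : Fin n) (f : E n → ℝ) (z : E n) : ℝ :=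
  fderiv ℝ f z (EuclideanSpace.single i 1)

/-- The fundamental tensor `g_ij(x,y) = ½ ∂²(F²)/∂yⁱ∂yʲ`. -/
def fundTensor {n : ℕ} (F : E n → E n → ℝ) (x y : E n) : Matrix (Fin n) (Fin n) ℝ :=
  Matrix.of fun i j => (1 / 2) * pd i (fun y' => pd j (fun y'' => F x y'' ^ 2) y') y

/-- The inner product `g_y(u,v) = g_ij(x,y) uⁱ vʲ`. -/
def gForm {n : ℕ} (F : E n → E n → ℝ) (x y u v : E n) : ℝ :=
  ∑ i, ∑ j, fundTensor F x y i j * u i * v j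

/-- `F` is a Finsler metric on `M`: it is smooth off the zero section (at points of `M` that are
not interior this means that `F` is given with a smooth extension to a neighbourhood) and its
restriction to every tangent space is a Minkowski norm. -/
structure IsFinslerMetric {n : ℕ} (M : Set (E n)) (F : E n → E n → ℝ) : Prop where
  smooth : ∀ x ∈ M, ∀ y : E n, y ≠ 0 →
    ContDiffAt ℝ ((⊤ : ℕ∞) : WithTop ℕ∞) (fun p : E n × E n => F p.1 p.2) (x, y)
  nonneg : ∀ x ∈ M, ∀ y : E n, 0 ≤ F x y
  eq_zero_iff : ∀ x ∈ M, ∀ y : E n, F x y = 0 ↔ y = 0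
  homogeneous : ∀ x ∈ M, ∀ y : E n, ∀ c : ℝ, 0 < c → F x (c • y) = c * F x y
  posDef : ∀ x ∈ M, ∀ y : E n, y ≠ 0 → ∀ u : E n, u ≠ 0 → 0 < gForm F x y u u

/-- `F(x,y) = |y| φ(|x|, ⟨x,y⟩/|y|)` on `M`, where `φ = φ(r,s)` is smooth at all the points
`(r,s) = (|x|, ⟨x,y⟩/|y|)` with `r > 0` that occur. -/
structure IsSphericallySymmetric {n : ℕ} (M : Set (E n)) (F : E n → E n → ℝ)
    (φ : ℝ → ℝ → ℝ) : Prop where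
  smooth : ∀ x ∈ M, x ≠ 0 → ∀ y : E n, y ≠ 0 →
    ContDiffAt ℝ ((⊤ : ℕ∞) : WithTop ℕ∞) (fun p : ℝ × ℝ => φ p.1 p.2)
      (‖x‖, inner ℝ x y / ‖y‖)
  eq : ∀ x ∈ M, ∀ y : E n, y ≠ 0 → F x y = ‖y‖ * φ ‖x‖ (inner ℝ x y / ‖y‖)

/-- The geodesic coefficients `Gⁱ = ¼ gⁱˡ ((F²)_{xᵏ yˡ} yᵏ - (F²)_{xˡ})`. -/
def geodesicCoeff {n : ℕ} (F : E n → E n → ℝ) (x y : E n) (i : Fin n) : ℝ :=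
  (1 / 4) * ∑ l, (fundTensor F x y)⁻¹ i l *
    ((∑ k, pd k (fun x' => pd l (fun y' => F x' y' ^ 2) y) x * y k)
      - pd l (fun x' => F x' y ^ 2) x)

/-- The Douglas curvature
`D_j^i_kl = ∂³/∂yʲ∂yᵏ∂yˡ (Gⁱ - (n+1)⁻¹ (∑ₘ ∂Gᵐ/∂yᵐ) yⁱ)`. -/
def douglasTensor {n : ℕ} (F : E n → E n → ℝ) (x y : E n) (j i k l : Fin n) : ℝ :=
  pd j (fun y₁ => pd k (fun y₂ => pd l (fun y₃ =>
    geodesicCoeff F x y₃ i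
      - 1 / ((n : ℝ) + 1) * (∑ m, pd m (fun y₄ => geodesicCoeff F x y₄ m) y₃) * y₃ i) y₂) y₁) y

/-- Vanishing Douglas curvature on `M`. -/
def IsDouglas {n : ℕ} (M : Set (E n)) (F : E n → E n → ℝ) : Prop :=
  ∀ x ∈ M, ∀ y : E n, y ≠ 0 → ∀ j i k l : Fin n, douglasTensor F x y j i k l = 0

/-- The Riemann curvature
`Rⁱ_k = 2 ∂Gⁱ/∂xᵏ - yʲ ∂²Gⁱ/∂xʲ∂yᵏ + 2 Gʲ ∂²Gⁱ/∂yʲ∂yᵏ - (∂Gⁱ/∂yʲ)(∂Gʲ/∂yᵏ)`. -/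
def riemann {n : ℕ} (F : E n → E n → ℝ) (x y : E n) (i k : Fin n) : ℝ :=
  2 * pd k (fun x' => geodesicCoeff F x' y i) x
    - (∑ j, y j * pd j (fun x' => pd k (fun y' => geodesicCoeff F x' y' i) y) x)
    + 2 * (∑ j, geodesicCoeff F x y j *
        pd j (fun y' => pd k (fun y'' => geodesicCoeff F x y'' i) y') y)
    - ∑ j, pd j (fun y' => geodesicCoeff F x y' i) y * pd k (fun y' => geodesicCoeff F x y' j) y

/-- The transformation `R_y(u) = Rⁱ_k(x,y) uᵏ`. -/
def riemannMap {n : ℕ} (F : E n → E n → ℝ) (x y u : E n) : E n :=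
  WithLp.toLp 2 fun i => ∑ k, riemann F x y i k * u k

/-- The flag curvature of the flag with pole `y` spanned by `y` and `u`. -/
def flagCurvature {n : ℕ} (F : E n → E n → ℝ) (x y u : E n) : ℝ :=
  gForm F x y (riemannMap F x y u) u /
    (gForm F x y y y * gForm F x y u u - gForm F x y y u ^ 2)

/-- All flag curvatures of `F` over `M` are equal to the real number `K`. -/
def HasConstantFlagCurvature {n : ℕ} (M : Set (E n)) (F : E n → E n → ℝ) (K : ℝ) : Prop :=
  ∀ x ∈ M, ∀ y u : E n, LinearIndependent ℝ ![y, u] → flagCurvature F x y u = K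

/-- `∂f/∂r` for `f = f(r,s)`. -/
def dr (f : ℝ → ℝ → ℝ) (r s : ℝ) : ℝ := deriv (fun t => f t s) r

/-- `∂f/∂s` for `f = f(r,s)`. -/
def ds (f : ℝ → ℝ → ℝ) (r s : ℝ) : ℝ := deriv (fun t => f r t) s

/-- `Q = (1/2r) (r φ_ss - φ_r + s φ_rs) / (φ - s φ_s + (r² - s²) φ_ss)`. -/
def Qfun (φ : ℝ → ℝ → ℝ) (r s : ℝ) : ℝ :=
  1 / (2 * r) * ((r * ds (ds φ) r s - dr φ r s + s * ds (dr φ) r s) /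
    (φ r s - s * ds φ r s + (r ^ 2 - s ^ 2) * ds (ds φ) r s))

/-- `P = (r φ_s + s φ_r) / (2 r φ) - (Q / φ) (s φ + (r² - s²) φ_s)`. -/
def Pfun (φ : ℝ → ℝ → ℝ) (r s : ℝ) : ℝ :=
  (r * ds φ r s + s * dr φ r s) / (2 * r * φ r s)
    - Qfun φ r s / φ r s * (s * φ r s + (r ^ 2 - s ^ 2) * ds φ r s)

/-- `R₁ = P² - (1/r)(s P_r + r P_s) + 2 Q (1 + s P + (r² - s²) P_s)`. -/
def R₁ (P Q : ℝ → ℝ → ℝ) (r s : ℝ) : ℝ :=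
  P r s ^ 2 - 1 / r * (s * dr P r s + r * ds P r s)
    + 2 * Q r s * (1 + s * P r s + (r ^ 2 - s ^ 2) * ds P r s)

end

end SphFinsler

/-! Over an interior point `x ≠ 0`, the spray is `Gⁱ = |y| P yⁱ + |y|² Q xⁱ`
(`IsSphericallySymmetric.geodesicCoeff_eq`). Differentiating such an expression produces only
multiples of `x_k`, `y_k` and `δ_ik`, so for fixed `i` the Riemann curvature is `α x_k + β y_k +
|y|² R₁ δ_ik` (`HasRadialSpray.riemann_eq`).

Since `n ≥ 3`, there is `u ≠ 0` Euclidean-orthogonal to both `x` and `y`. For it `R_y(u) = |y|² R₁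
u`, whatever `α` and `β` are. Moreover `g_y(y,u) = 0` and `g_y(y,y) = |y|² φ²`, so the flag
curvature of `(y,u)` is `R₁/φ²`; constancy of the curvature makes this `K`
(`IsSphericallySymmetric.eq_of_mem_interior`).

A noninterior point can occur only on the inner sphere of a half-closed annulus. There the identity
follows by letting `t ↓ 1` along `t • x`, as both sides are continuous. -/

namespace SphFinsler

noncomputable section

open Filter Topology

variable {n : ℕ}

/-! ### Calculus of coordinate partial derivatives. -/

/-- `f` is differentiable at `z` with `∂f/∂zⁱ = f'` there. -/
def HasPd (i : Fin n) (f : E n → ℝ) (f' : ℝ) (z : E n) : Prop :=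
  DifferentiableAt ℝ f z ∧ pd i f z = f'

namespace HasPd

variable {i : Fin n} {f g : E n → ℝ} {f' g' : ℝ} {z : E n}

theorem of_hasFDerivAt {L : E n →L[ℝ] ℝ} (h : HasFDerivAt f L z)
    (hL : L (EuclideanSpace.single i 1) = f') : HasPd i f f' z :=
  ⟨h.differentiableAt, by rw [pd, h.fderiv, hL]⟩

theorem const (c : ℝ) : HasPd i (fun _ => c) 0 z :=
  of_hasFDerivAt (hasFDerivAt_const c z) rfl

theorem coord (j : Fin n) : HasPd i (fun z => z j) (if i = j then 1 else 0) z :=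
  of_hasFDerivAt (EuclideanSpace.proj (𝕜 := ℝ) j).hasFDerivAt (by simp [eq_comm])

theorem add (hf : HasPd i f f' z) (hg : HasPd i g g' z) :
    HasPd i (fun z => f z + g z) (f' + g') z :=
  of_hasFDerivAt (hf.1.hasFDerivAt.add hg.1.hasFDerivAt) (by rw [← hf.2, ← hg.2]; rfl)

theorem mul (hf : HasPd i f f' z) (hg : HasPd i g g' z) :
    HasPd i (fun z => f z * g z) (f' * g z + f z * g') z :=
  of_hasFDerivAt (hf.1.hasFDerivAt.mul hg.1.hasFDerivAt) (by
    rw [← hf.2, ← hg.2]; simp [pd]; ring)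

theorem mul_const (hf : HasPd i f f' z) (c : ℝ) : HasPd i (fun z => f z * c) (f' * c) z := by
  simpa using hf.mul (const c)

theorem const_mul (hf : HasPd i f f' z) (c : ℝ) : HasPd i (fun z => c * f z) (c * f') z := by
  simpa using (const c).mul hf

theorem norm (hz : z ≠ 0) : HasPd i (fun z => ‖z‖) (z i / ‖z‖) z := by
  have h := (hasStrictFDerivAt_norm_sq z).hasFDerivAt.sqrt (by positivity)
  simp only [Real.sqrt_sq (norm_nonneg _)] at h
  refine of_hasFDerivAt h ?_
  simp [EuclideanSpace.inner_single_right]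
  ring

/-- Local equality is what is available: the closed formulas hold only for `y ≠ 0`, or only for `x`
in the interior of `M`. -/
theorem congr (hf : HasPd i f f' z) (h : g =ᶠ[𝓝 z] f) (h' : f' = g') : HasPd i g g' z :=
  ⟨hf.1.congr_of_eventuallyEq h, by rw [pd, h.fderiv_eq, ← h', ← hf.2, pd]⟩

end HasPd

/-! ### Smooth functions of `(r,s)` and their partial derivatives. -/

/-- The function `ψ(|x|, ⟨x,y⟩/|y|)`. -/
def radial (ψ : ℝ → ℝ → ℝ) (x y : E n) : ℝ := ψ ‖x‖ (inner ℝ x y / ‖y‖)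

/-- Smoothness of `ψ(r,s)` at a point. -/
abbrev SmoothAt (ψ : ℝ → ℝ → ℝ) (r s : ℝ) : Prop :=
  ContDiffAt ℝ ((⊤ : ℕ∞) : WithTop ℕ∞) (fun p : ℝ × ℝ => ψ p.1 p.2) (r, s)

section Partials

variable {ψ : ℝ → ℝ → ℝ} {r s : ℝ}

theorem hasDerivAt_ds_of_differentiableAt
    (h : DifferentiableAt ℝ (fun p : ℝ × ℝ => ψ p.1 p.2) (r, s)) :
    HasDerivAt (fun t => ψ r t) (fderiv ℝ (fun p : ℝ × ℝ => ψ p.1 p.2) (r, s) (0, 1)) s :=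
  HasFDerivAt.comp_hasDerivAt (l := fun p : ℝ × ℝ => ψ p.1 p.2) (f := fun t => (r, t)) s
    h.hasFDerivAt ((hasDerivAt_const s r).prodMk (hasDerivAt_id s))

theorem hasDerivAt_dr_of_differentiableAt
    (h : DifferentiableAt ℝ (fun p : ℝ × ℝ => ψ p.1 p.2) (r, s)) :
    HasDerivAt (fun t => ψ t s) (fderiv ℝ (fun p : ℝ × ℝ => ψ p.1 p.2) (r, s) (1, 0)) r :=
  HasFDerivAt.comp_hasDerivAt (l := fun p : ℝ × ℝ => ψ p.1 p.2) (f := fun t => (t, s)) r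
    h.hasFDerivAt ((hasDerivAt_id r).prodMk (hasDerivAt_const r s))

theorem ds_eq_fderiv (h : DifferentiableAt ℝ (fun p : ℝ × ℝ => ψ p.1 p.2) (r, s)) :
    ds ψ r s = fderiv ℝ (fun p : ℝ × ℝ => ψ p.1 p.2) (r, s) (0, 1) :=
  (hasDerivAt_ds_of_differentiableAt h).deriv

theorem dr_eq_fderiv (h : DifferentiableAt ℝ (fun p : ℝ × ℝ => ψ p.1 p.2) (r, s)) :
    dr ψ r s = fderiv ℝ (fun p : ℝ × ℝ => ψ p.1 p.2) (r, s) (1, 0) :=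
  (hasDerivAt_dr_of_differentiableAt h).deriv

theorem SmoothAt.differentiableAt (h : SmoothAt ψ r s) :
    DifferentiableAt ℝ (fun p : ℝ × ℝ => ψ p.1 p.2) (r, s) :=
  ContDiffAt.differentiableAt h (by simp)

/-- Differentiability on a whole neighbourhood identifies `ds ψ` and `dr ψ` with components of
`fderiv` near the point, so that they are smooth in turn. -/
theorem SmoothAt.eventually_differentiableAt (h : SmoothAt ψ r s) :
    ∀ᶠ p in 𝓝 (r, s), DifferentiableAt ℝ (fun p : ℝ × ℝ => ψ p.1 p.2) p := by
  have h1 : ContDiffAt ℝ 1 (fun p : ℝ × ℝ => ψ p.1 p.2) (r, s) := h.of_le (by norm_cast)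
  filter_upwards [h1.eventually (by simp)] with p hp
  exact hp.differentiableAt (by simp)

theorem SmoothAt.eventually_ds (h : SmoothAt ψ r s) :
    (fun p : ℝ × ℝ => ds ψ p.1 p.2) =ᶠ[𝓝 (r, s)]
      fun p => fderiv ℝ (fun p : ℝ × ℝ => ψ p.1 p.2) p (0, 1) := by
  filter_upwards [h.eventually_differentiableAt] with p hp using ds_eq_fderiv hp

theorem SmoothAt.eventually_dr (h : SmoothAt ψ r s) :
    (fun p : ℝ × ℝ => dr ψ p.1 p.2) =ᶠ[𝓝 (r, s)]
      fun p => fderiv ℝ (fun p : ℝ × ℝ => ψ p.1 p.2) p (1, 0) := by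
  filter_upwards [h.eventually_differentiableAt] with p hp using dr_eq_fderiv hp

theorem SmoothAt.ds (h : SmoothAt ψ r s) : SmoothAt (ds ψ) r s :=
  ((ContDiffAt.fderiv_right h (by simp)).clm_apply contDiffAt_const).congr_of_eventuallyEq
    h.eventually_ds

theorem SmoothAt.dr (h : SmoothAt ψ r s) : SmoothAt (dr ψ) r s :=
  ((ContDiffAt.fderiv_right h (by simp)).clm_apply contDiffAt_const).congr_of_eventuallyEq
    h.eventually_dr

/-- `Qfun` contains `ds (dr φ)`, while differentiating the metric coefficients in `r` yields `dr (ds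
φ)`. -/
theorem SmoothAt.ds_dr_comm (h : SmoothAt ψ r s) :
    SphFinsler.ds (SphFinsler.dr ψ) r s = SphFinsler.dr (SphFinsler.ds ψ) r s := by
  have hd : DifferentiableAt ℝ (fderiv ℝ fun p : ℝ × ℝ => ψ p.1 p.2) (r, s) :=
    (ContDiffAt.fderiv_right (m := (⊤ : ℕ∞)) h (by simp)).differentiableAt (by simp)
  have hsymm : IsSymmSndFDerivAt ℝ (fun p : ℝ × ℝ => ψ p.1 p.2) (r, s) :=
    ContDiffAt.isSymmSndFDerivAt h (by
      simpa using WithTop.coe_le_coe.2 (le_top : (2 : ℕ∞) ≤ ⊤))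
  rw [ds_eq_fderiv h.dr.differentiableAt, dr_eq_fderiv h.ds.differentiableAt,
    h.eventually_ds.fderiv_eq, h.eventually_dr.fderiv_eq,
    fderiv_clm_apply hd (by fun_prop), fderiv_clm_apply hd (by fun_prop)]
  simpa using hsymm (0, 1) (1, 0)

theorem SmoothAt.hasDerivAt_ds (h : SmoothAt ψ r s) :
    HasDerivAt (fun t => ψ r t) (SphFinsler.ds ψ r s) s := by
  rw [ds_eq_fderiv h.differentiableAt]
  exact hasDerivAt_ds_of_differentiableAt h.differentiableAt

theorem SmoothAt.hasDerivAt_dr (h : SmoothAt ψ r s) :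
    HasDerivAt (fun t => ψ t s) (SphFinsler.dr ψ r s) r := by
  rw [dr_eq_fderiv h.differentiableAt]
  exact hasDerivAt_dr_of_differentiableAt h.differentiableAt

end Partials

/-! ### Chain rule for radial functions. -/

section Radial

variable {ψ : ℝ → ℝ → ℝ} {x y : E n} {i : Fin n}

theorem fderiv_apply_eq (h : SmoothAt ψ ‖x‖ (inner ℝ x y / ‖y‖)) (a b : ℝ) :
    fderiv ℝ (fun p : ℝ × ℝ => ψ p.1 p.2) (‖x‖, inner ℝ x y / ‖y‖) (a, b) =
      radial (dr ψ) x y * a + radial (ds ψ) x y * b := by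
  rw [radial, radial, dr_eq_fderiv h.differentiableAt, ds_eq_fderiv h.differentiableAt,
    mul_comm _ a, mul_comm _ b, ← smul_eq_mul, ← smul_eq_mul, ← map_smul, ← map_smul, ← map_add]
  simp

theorem HasPd.inner_const_left (x y : E n) : HasPd i (fun y' => inner ℝ x y') (x i) y :=
  .of_hasFDerivAt (innerSL ℝ x).hasFDerivAt (by simp [EuclideanSpace.inner_single_right])

theorem HasPd.inner_const_right (x y : E n) : HasPd i (fun x' => inner ℝ x' y) (y i) x := by
  simpa only [real_inner_comm] using HasPd.inner_const_left (i := i) y x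

theorem HasPd.inv {f : E n → ℝ} {f' : ℝ} {z : E n} (hf : HasPd i f f' z) (h : f z ≠ 0) :
    HasPd i (fun z => (f z)⁻¹) (-f' / f z ^ 2) z :=
  .of_hasFDerivAt ((hasDerivAt_inv h).comp_hasFDerivAt z hf.1.hasFDerivAt) (by
    rw [← hf.2]; simp [pd]; ring)

theorem HasPd.radial_snd (h : SmoothAt ψ ‖x‖ (inner ℝ x y / ‖y‖)) (hy : y ≠ 0) :
    HasPd i (fun y' => radial ψ x y')
      (radial (ds ψ) x y * (x i / ‖y‖ - inner ℝ x y / ‖y‖ * y i / ‖y‖ ^ 2)) y := by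
  have hy' : ‖y‖ ≠ 0 := norm_ne_zero_iff.2 hy
  have h2 := (HasPd.inner_const_left (i := i) x y).mul ((HasPd.norm (i := i) hy).inv hy')
  simp only [← div_eq_mul_inv] at h2
  refine .of_hasFDerivAt (HasFDerivAt.comp (g := fun p : ℝ × ℝ => ψ p.1 p.2)
    (f := fun y' => (‖x‖, inner ℝ x y' / ‖y'‖)) y h.differentiableAt.hasFDerivAt
    ((hasFDerivAt_const ‖x‖ y).prodMk h2.1.hasFDerivAt)) ?_
  have h3 := h2.2
  rw [pd] at h3
  simp only [ContinuousLinearMap.comp_apply, ContinuousLinearMap.prod_apply, h3,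
    zero_apply, fderiv_apply_eq h]
  field_simp
  ring

theorem HasPd.radial_fst (h : SmoothAt ψ ‖x‖ (inner ℝ x y / ‖y‖)) (hx : x ≠ 0) :
    HasPd i (fun x' => radial ψ x' y)
      (radial (dr ψ) x y * (x i / ‖x‖) + radial (ds ψ) x y * (y i / ‖y‖)) x := by
  have h1 := HasPd.norm (i := i) hx
  have h2 := (HasPd.inner_const_right (i := i) x y).mul_const (‖y‖⁻¹)
  simp only [← div_eq_mul_inv] at h2
  refine .of_hasFDerivAt (HasFDerivAt.comp (g := fun p : ℝ × ℝ => ψ p.1 p.2)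
    (f := fun x' => (‖x'‖, inner ℝ x' y / ‖y‖)) x h.differentiableAt.hasFDerivAt
    (h1.1.hasFDerivAt.prodMk h2.1.hasFDerivAt)) ?_
  have h3 := h2.2
  have h4 := h1.2
  rw [pd] at h3 h4
  simp only [ContinuousLinearMap.comp_apply, ContinuousLinearMap.prod_apply, h3, h4,
    fderiv_apply_eq h]

end Radial

/-! ### Coefficients of the fundamental tensor. -/

/-- The coefficient `φ² - s φ φ_s` of `δ_ij` in the fundamental tensor. -/
def coeffA (φ : ℝ → ℝ → ℝ) (r s : ℝ) : ℝ := φ r s ^ 2 - s * (φ r s * ds φ r s)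

/-- The function `φ φ_s`. -/
def coeffB (φ : ℝ → ℝ → ℝ) (r s : ℝ) : ℝ := φ r s * ds φ r s

/-- The coefficient `φ_s² + φ φ_ss` of `xⁱ xʲ` in the fundamental tensor. -/
def coeffC (φ : ℝ → ℝ → ℝ) (r s : ℝ) : ℝ := ds φ r s ^ 2 + φ r s * ds (ds φ) r s

section Coefficients

variable {φ ψ : ℝ → ℝ → ℝ} {r s : ℝ}

theorem SmoothAt.mul (h : SmoothAt φ r s) (h' : SmoothAt ψ r s) :
    SmoothAt (fun r s => φ r s * ψ r s) r s := ContDiffAt.mul h h'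

theorem SmoothAt.add (h : SmoothAt φ r s) (h' : SmoothAt ψ r s) :
    SmoothAt (fun r s => φ r s + ψ r s) r s := ContDiffAt.add h h'

theorem SmoothAt.sub (h : SmoothAt φ r s) (h' : SmoothAt ψ r s) :
    SmoothAt (fun r s => φ r s - ψ r s) r s := ContDiffAt.sub h h'

theorem SmoothAt.pow (h : SmoothAt φ r s) (k : ℕ) :
    SmoothAt (fun r s => φ r s ^ k) r s := ContDiffAt.pow h k

theorem SmoothAt.div (h : SmoothAt φ r s) (h' : SmoothAt ψ r s) (h0 : ψ r s ≠ 0) :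
    SmoothAt (fun r s => φ r s / ψ r s) r s := ContDiffAt.div h h' h0

theorem smoothAt_const (c : ℝ) : SmoothAt (fun _ _ => c) r s := contDiffAt_const

theorem smoothAt_fst : SmoothAt (fun r _ => r) r s := contDiffAt_fst

theorem smoothAt_snd : SmoothAt (fun _ s => s) r s := contDiffAt_snd

theorem SmoothAt.coeffA (h : SmoothAt φ r s) : SmoothAt (coeffA φ) r s :=
  (h.pow 2).sub (smoothAt_snd.mul (h.mul h.ds))

theorem SmoothAt.coeffB (h : SmoothAt φ r s) : SmoothAt (coeffB φ) r s := h.mul h.ds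

theorem ds_coeffB (h : SmoothAt φ r s) : ds (coeffB φ) r s = coeffC φ r s :=
  ((h.hasDerivAt_ds.mul h.ds.hasDerivAt_ds).deriv).trans (by rw [coeffC]; ring)

theorem ds_coeffA (h : SmoothAt φ r s) :
    ds (coeffA φ) r s = coeffB φ r s - s * coeffC φ r s :=
  (((h.hasDerivAt_ds.pow 2).sub
    ((hasDerivAt_id s).mul (h.hasDerivAt_ds.mul h.ds.hasDerivAt_ds))).deriv).trans (by
      simp [coeffB, coeffC]; ring)

theorem dr_coeffB (h : SmoothAt φ r s) :
    dr (coeffB φ) r s = dr φ r s * ds φ r s + φ r s * dr (ds φ) r s :=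
  (h.hasDerivAt_dr.mul h.ds.hasDerivAt_dr).deriv

theorem dr_coeffA (h : SmoothAt φ r s) :
    dr (coeffA φ) r s = 2 * φ r s * dr φ r s - s * dr (coeffB φ) r s :=
  (((h.hasDerivAt_dr.pow 2).sub ((h.coeffB.hasDerivAt_dr).const_mul s)).deriv).trans (by simp)

end Coefficients

/-! ### First and second derivatives of `F²`. -/

section Energy

variable {φ : ℝ → ℝ → ℝ} {x y : E n}

theorem hasPd_energy_snd (h : SmoothAt φ ‖x‖ (inner ℝ x y / ‖y‖)) (hy : y ≠ 0) (l : Fin n) :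
    HasPd l (fun y' => (‖y'‖ * radial φ x y') ^ 2)
      (2 * radial (coeffA φ) x y * y l + 2 * ‖y‖ * radial (coeffB φ) x y * x l) y := by
  have hy' : ‖y‖ ≠ 0 := norm_ne_zero_iff.2 hy
  have h1 := (HasPd.norm (i := l) hy).mul (HasPd.radial_snd (i := l) h hy)
  refine (h1.mul h1).congr (.of_forall fun z => by ring) ?_
  simp only [radial, coeffA, coeffB]
  field_simp
  ring

theorem hasPd_energy_fst (h : SmoothAt φ ‖x‖ (inner ℝ x y / ‖y‖)) (hx : x ≠ 0) (hy : y ≠ 0)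
    (l : Fin n) :
    HasPd l (fun x' => (‖y‖ * radial φ x' y) ^ 2)
      (2 * ‖y‖ ^ 2 * (radial φ x y * radial (dr φ) x y) / ‖x‖ * x l
        + 2 * ‖y‖ * radial (coeffB φ) x y * y l) x := by
  have hy' : ‖y‖ ≠ 0 := norm_ne_zero_iff.2 hy
  have h1 := (HasPd.radial_fst (i := l) h hx).const_mul ‖y‖
  refine (h1.mul h1).congr (.of_forall fun z => by ring) ?_
  simp only [radial, coeffB]
  field_simp
  ring

/-- The relations `A_s = B - s C` and `B_s = C` are why the three coefficients suffice. -/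
theorem hasPd_energy_snd_snd (h : SmoothAt φ ‖x‖ (inner ℝ x y / ‖y‖)) (hy : y ≠ 0)
    (i l : Fin n) :
    HasPd i (fun y' => 2 * radial (coeffA φ) x y' * y' l
        + 2 * ‖y'‖ * radial (coeffB φ) x y' * x l)
      (2 * (radial (coeffA φ) x y * (if i = l then 1 else 0)
        + (radial (coeffB φ) x y - inner ℝ x y / ‖y‖ * radial (coeffC φ) x y) / ‖y‖
          * (x i * y l + y i * x l)
        - inner ℝ x y / ‖y‖ * (radial (coeffB φ) x y
          - inner ℝ x y / ‖y‖ * radial (coeffC φ) x y) / ‖y‖ ^ 2 * (y i * y l)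
        + radial (coeffC φ) x y * (x i * x l))) y := by
  have hy' : ‖y‖ ≠ 0 := norm_ne_zero_iff.2 hy
  have h1 := (((HasPd.radial_snd (i := i) h.coeffA hy).const_mul 2).mul (HasPd.coord l)).add
    ((((HasPd.norm (i := i) hy).const_mul 2).mul
      (HasPd.radial_snd (i := i) h.coeffB hy)).mul_const (x l))
  refine h1.congr (.of_forall fun z => rfl) ?_
  have e1 : radial (ds (coeffA φ)) x y =
    radial (coeffB φ) x y - inner ℝ x y / ‖y‖ * radial (coeffC φ) x y := ds_coeffA h
  have e2 : radial (ds (coeffB φ)) x y = radial (coeffC φ) x y := ds_coeffB h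
  rw [e1, e2]
  generalize (if i = l then (1 : ℝ) else 0) = d
  field_simp
  ring

theorem hasPd_energy_snd_fst (h : SmoothAt φ ‖x‖ (inner ℝ x y / ‖y‖)) (hx : x ≠ 0)
    (k l : Fin n) :
    HasPd k (fun x' => 2 * radial (coeffA φ) x' y * y l
        + 2 * ‖y‖ * radial (coeffB φ) x' y * x' l)
      (2 * (radial (dr (coeffA φ)) x y * (x k / ‖x‖)
          + radial (ds (coeffA φ)) x y * (y k / ‖y‖)) * y l
        + 2 * ‖y‖ * (radial (dr (coeffB φ)) x y * (x k / ‖x‖)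
          + radial (ds (coeffB φ)) x y * (y k / ‖y‖)) * x l
        + 2 * ‖y‖ * radial (coeffB φ) x y * (if k = l then 1 else 0)) x := by
  have h1 := (((HasPd.radial_fst (i := k) h.coeffA hx).const_mul 2).mul_const (y l)).add
    (((HasPd.radial_fst (i := k) h.coeffB hx).const_mul (2 * ‖y‖)).mul (HasPd.coord l))
  refine h1.congr (.of_forall fun z => rfl) ?_
  ring

end Energy

theorem sum_coord_mul_coord (x y : E n) : ∑ i, x i * y i = inner ℝ x y := by
  simp [PiLp.inner_apply, mul_comm]

theorem sum_coord_mul_self (x : E n) : ∑ i, x i * x i = ‖x‖ ^ 2 := by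
  rw [sum_coord_mul_coord, real_inner_self_eq_norm_sq]

/-! ### The fundamental tensor and consequences of its positivity. -/

section Metric

variable {M : Set (E n)} {F : E n → E n → ℝ} {φ : ℝ → ℝ → ℝ} {x y : E n}

theorem IsSphericallySymmetric.smoothAt (hφ : IsSphericallySymmetric M F φ) (hxM : x ∈ M)
    (hx : x ≠ 0) (hy : y ≠ 0) : SmoothAt φ ‖x‖ (inner ℝ x y / ‖y‖) := hφ.smooth x hxM hx y hy

theorem IsSphericallySymmetric.sq_eventuallyEq (hφ : IsSphericallySymmetric M F φ) (hxM : x ∈ M)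
    (hy : y ≠ 0) :
    (fun y' => F x y' ^ 2) =ᶠ[𝓝 y] fun y' => (‖y'‖ * radial φ x y') ^ 2 := by
  filter_upwards [isOpen_ne.mem_nhds hy] with z hz
  rw [hφ.eq x hxM z hz, radial]

theorem IsSphericallySymmetric.hasPd_sq_snd (hφ : IsSphericallySymmetric M F φ) (hxM : x ∈ M)
    (hx : x ≠ 0) (hy : y ≠ 0) (l : Fin n) :
    HasPd l (fun y' => F x y' ^ 2)
      (2 * radial (coeffA φ) x y * y l + 2 * ‖y‖ * radial (coeffB φ) x y * x l) y :=
  (hasPd_energy_snd (hφ.smoothAt hxM hx hy) hy l).congr (hφ.sq_eventuallyEq hxM hy) rfl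

theorem IsSphericallySymmetric.fundTensor_apply (hφ : IsSphericallySymmetric M F φ) (hxM : x ∈ M)
    (hx : x ≠ 0) (hy : y ≠ 0) (i l : Fin n) :
    fundTensor F x y i l = radial (coeffA φ) x y * (if i = l then 1 else 0)
        + (radial (coeffB φ) x y - inner ℝ x y / ‖y‖ * radial (coeffC φ) x y) / ‖y‖
          * (x i * y l + y i * x l)
        - inner ℝ x y / ‖y‖ * (radial (coeffB φ) x y
          - inner ℝ x y / ‖y‖ * radial (coeffC φ) x y) / ‖y‖ ^ 2 * (y i * y l)
        + radial (coeffC φ) x y * (x i * x l) := by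
  have h1 := (hasPd_energy_snd_snd (hφ.smoothAt hxM hx hy) hy i l).congr
    (g := fun y' => pd l (fun y'' => F x y'' ^ 2) y') (by
      filter_upwards [isOpen_ne.mem_nhds hy] with z hz
      exact (hφ.hasPd_sq_snd hxM hx hz l).2) rfl
  rw [fundTensor, Matrix.of_apply, h1.2]
  ring

theorem IsSphericallySymmetric.gForm_eq (hφ : IsSphericallySymmetric M F φ) (hxM : x ∈ M)
    (hx : x ≠ 0) (hy : y ≠ 0) (u v : E n) :
    gForm F x y u v = radial (coeffA φ) x y * inner ℝ u v
        + (radial (coeffB φ) x y - inner ℝ x y / ‖y‖ * radial (coeffC φ) x y) / ‖y‖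
          * (inner ℝ x u * inner ℝ y v + inner ℝ y u * inner ℝ x v)
        - inner ℝ x y / ‖y‖ * (radial (coeffB φ) x y
          - inner ℝ x y / ‖y‖ * radial (coeffC φ) x y) / ‖y‖ ^ 2 * (inner ℝ y u * inner ℝ y v)
        + radial (coeffC φ) x y * (inner ℝ x u * inner ℝ x v) := by
  have h1 : ∀ i, ∑ j, fundTensor F x y i j * u i * v j =
      radial (coeffA φ) x y * (u i * v i)
        + (radial (coeffB φ) x y - inner ℝ x y / ‖y‖ * radial (coeffC φ) x y) / ‖y‖
          * (x i * u i * inner ℝ y v + y i * u i * inner ℝ x v)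
        - inner ℝ x y / ‖y‖ * (radial (coeffB φ) x y
          - inner ℝ x y / ‖y‖ * radial (coeffC φ) x y) / ‖y‖ ^ 2 * (y i * u i * inner ℝ y v)
        + radial (coeffC φ) x y * (x i * u i * inner ℝ x v) := by
    intro i
    have h2 : u i * v i = ∑ j, (if i = j then 1 else 0) * u i * v j := by simp
    rw [h2, ← sum_coord_mul_coord y v, ← sum_coord_mul_coord x v]
    simp only [Finset.mul_sum, ← Finset.sum_add_distrib, ← Finset.sum_sub_distrib]
    refine Finset.sum_congr rfl fun j _ => ?_
    rw [hφ.fundTensor_apply hxM hx hy]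
    ring
  rw [gForm, Finset.sum_congr rfl fun i _ => h1 i, ← sum_coord_mul_coord u v,
    ← sum_coord_mul_coord x u, ← sum_coord_mul_coord y u]
  simp only [Finset.mul_sum, Finset.sum_mul, ← Finset.sum_add_distrib, ← Finset.sum_sub_distrib]

theorem IsSphericallySymmetric.radial_pos (hφ : IsSphericallySymmetric M F φ)
    (hF : IsFinslerMetric M F) (hxM : x ∈ M) (hy : y ≠ 0) : 0 < radial φ x y := by
  have h1 : 0 < F x y :=
    lt_of_le_of_ne (hF.nonneg x hxM y) fun h => hy ((hF.eq_zero_iff x hxM y).1 h.symm)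
  rw [hφ.eq x hxM y hy] at h1
  exact pos_of_mul_pos_right h1 (norm_nonneg y)

/-- The span of `x` and `y` has dimension at most 2, so its orthogonal complement is nonzero. -/
theorem exists_ne_zero_orthogonal (hn : 3 ≤ n) (x y : E n) :
    ∃ u : E n, u ≠ 0 ∧ inner ℝ x u = 0 ∧ inner ℝ y u = 0 := by
  have h1 : Module.finrank ℝ (Submodule.span ℝ ({x, y} : Set (E n))) ≤ 2 := by
    have := finrank_span_finset_le_card (R := ℝ) ({x, y} : Finset (E n))
    simp only [Finset.coe_insert, Finset.coe_singleton] at this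
    exact this.trans Finset.card_le_two
  have h2 := (Submodule.span ℝ ({x, y} : Set (E n))).finrank_add_finrank_orthogonal
  rw [finrank_euclideanSpace_fin] at h2
  obtain ⟨u, hu, hu0⟩ := Submodule.exists_mem_ne_zero_of_ne_bot
    (p := (Submodule.span ℝ ({x, y} : Set (E n)))ᗮ) (by
      intro h
      rw [h, finrank_bot] at h2
      omega)
  refine ⟨u, hu0, hu x (Submodule.subset_span (by simp)), hu y (Submodule.subset_span (by simp))⟩

theorem IsSphericallySymmetric.gForm_orthogonal (hφ : IsSphericallySymmetric M F φ) (hxM : x ∈ M)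
    (hx : x ≠ 0) (hy : y ≠ 0) {u : E n} (hxu : inner ℝ x u = 0) (hyu : inner ℝ y u = 0) (v : E n) :
    gForm F x y v u = radial (coeffA φ) x y * inner ℝ v u := by
  rw [hφ.gForm_eq hxM hx hy, hxu, hyu]
  ring

theorem IsSphericallySymmetric.coeffA_pos (hφ : IsSphericallySymmetric M F φ)
    (hF : IsFinslerMetric M F) (hn : 3 ≤ n) (hxM : x ∈ M) (hx : x ≠ 0) (hy : y ≠ 0) :
    0 < radial (coeffA φ) x y := by
  obtain ⟨u, hu0, hxu, hyu⟩ := exists_ne_zero_orthogonal hn x y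
  have h1 := hF.posDef x hxM y hy u hu0
  rw [hφ.gForm_orthogonal hxM hx hy hxu hyu] at h1
  exact pos_of_mul_pos_left h1 real_inner_self_nonneg

/-- The denominator `φ - s φ_s + (r² - s²) φ_ss` of `Q`. -/
def denomQ (φ : ℝ → ℝ → ℝ) (r s : ℝ) : ℝ :=
  φ r s - s * ds φ r s + (r ^ 2 - s ^ 2) * ds (ds φ) r s

theorem IsSphericallySymmetric.denomQ_ne_zero (hφ : IsSphericallySymmetric M F φ)
    (hF : IsFinslerMetric M F) (hn : 3 ≤ n) (hxM : x ∈ M) (hx : x ≠ 0) (hy : y ≠ 0) :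
    radial (denomQ φ) x y ≠ 0 := by
  have hy' : ‖y‖ ≠ 0 := norm_ne_zero_iff.2 hy
  have hφ0 := hφ.radial_pos hF hxM hy
  have hA := hφ.coeffA_pos hF hn hxM hx hy
  intro hD
  simp only [radial, denomQ, coeffA] at hφ0 hA hD
  set s := inner ℝ x y / ‖y‖ with hs
  have hxy : inner ℝ x y = s * ‖y‖ := by rw [hs]; field_simp
  set r := ‖x‖
  -- If `r² = s²`, the denominator is `φ - s φ_s`, whose product with `φ` is `coeffA > 0`.
  have hne : r ^ 2 - s ^ 2 ≠ 0 := by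
    intro h
    rw [h] at hD
    have : φ r s * (φ r s - s * ds φ r s + 0 * ds (ds φ) r s) = 0 := by rw [hD, mul_zero]
    nlinarith
  -- `c = g_y(x,y)/g_y(y,y)`, so `x - c y` is the `g_y`-orthogonal projection of `x` off `y`. Its
  -- `g_y`-square is `φ (r² - s²)` times the denominator, hence would vanish.
  set c := s / ‖y‖ + ds φ r s * (r ^ 2 - s ^ 2) / (‖y‖ * φ r s) with hc
  have hyx : inner ℝ y x = s * ‖y‖ := by rw [real_inner_comm, hxy]
  have hxx : inner ℝ x x = r ^ 2 := real_inner_self_eq_norm_sq x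
  have hyy : inner ℝ y y = ‖y‖ ^ 2 := real_inner_self_eq_norm_sq y
  -- If `x` were a multiple of `y`, equality in Cauchy–Schwarz would give `r² = s²`.
  have hu : x - c • y ≠ 0 := by
    intro h
    have h1 : x = c • y := sub_eq_zero.1 h
    have h2 : inner ℝ x y = c * ‖y‖ ^ 2 := by
      conv_lhs => rw [h1]
      rw [real_inner_smul_left, hyy]
    have h3 : r ^ 2 = c * inner ℝ x y := by
      rw [← hxx]
      conv_lhs => rw [h1]
      rw [real_inner_smul_left, ← h1, real_inner_comm]
    apply hne
    rw [hxy] at h2 h3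
    have h4 : s = c * ‖y‖ := mul_right_cancel₀ hy' (by linarith)
    rw [h3]
    nth_rewrite 1 [h4]
    rw [h4]
    ring
  have h1 := hF.posDef x hxM y hy _ hu
  rw [hφ.gForm_eq hxM hx hy] at h1
  simp only [inner_sub_left, inner_sub_right, real_inner_smul_left, real_inner_smul_right,
    hxx, hyy, hxy, hyx, radial, coeffA, coeffB, coeffC] at h1
  rw [mul_div_cancel_right₀ _ hy'] at h1
  refine h1.ne' ?_
  have h2 : φ r s * ((r ^ 2 - s ^ 2) * (φ r s - s * ds φ r s
    + (r ^ 2 - s ^ 2) * ds (ds φ) r s)) = 0 := by rw [hD]; ring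
  rw [← h2, hc]
  have := hφ0.ne'
  field_simp
  ring

end Metric

/-! ### The geodesic coefficients. -/

theorem sum_frame_mul (α β γ : ℝ) (x y u : E n) (l : Fin n) :
    ∑ k, (α * x k + β * y k + γ * (if k = l then 1 else 0)) * u k =
      α * inner ℝ x u + β * inner ℝ y u + γ * u l := by
  have h : u l = ∑ k, (if k = l then 1 else 0) * u k := by simp
  rw [h, ← sum_coord_mul_coord x u, ← sum_coord_mul_coord y u]
  simp only [Finset.mul_sum, ← Finset.sum_add_distrib]
  exact Finset.sum_congr rfl fun k _ => by ring

section Metric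

variable {M : Set (E n)} {F : E n → E n → ℝ} {φ : ℝ → ℝ → ℝ} {x y : E n}

/-- Positive definiteness makes the matrix invertible, so an explicit solution of `g w = v` replaces
a formula for the inverse. -/
theorem fundTensor_mulVec_inv (hF : IsFinslerMetric M F) (hxM : x ∈ M) (hy : y ≠ 0)
    {w v : Fin n → ℝ} (h : ∀ i, ∑ l, fundTensor F x y i l * w l = v i) (i : Fin n) :
    ∑ l, (fundTensor F x y)⁻¹ i l * v l = w i := by
  have hdet : IsUnit (fundTensor F x y).det := by
    refine isUnit_iff_ne_zero.2 fun h0 => ?_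
    obtain ⟨u, hu0, hu⟩ := Matrix.exists_mulVec_eq_zero_iff.2 h0
    refine (hF.posDef x hxM y hy (WithLp.toLp 2 u) (by simpa using hu0)).ne' ?_
    refine Finset.sum_eq_zero fun i _ => ?_
    have := congrFun hu i
    simp only [Matrix.mulVec, dotProduct, Pi.zero_apply] at this
    simp only [mul_right_comm _ (u i)]
    rw [← Finset.sum_mul, this, zero_mul]
  have h1 : (fundTensor F x y).mulVec w = v := funext h
  have h2 : (fundTensor F x y)⁻¹.mulVec v = w := by
    rw [← h1, Matrix.mulVec_mulVec, Matrix.nonsing_inv_mul _ hdet, Matrix.one_mulVec]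
  exact congrFun h2 i

theorem IsSphericallySymmetric.sum_fundTensor_mul (hφ : IsSphericallySymmetric M F φ)
    (hxM : x ∈ M) (hx : x ≠ 0) (hy : y ≠ 0) (w : E n) (i : Fin n) :
    ∑ l, fundTensor F x y i l * w l = radial (coeffA φ) x y * w i
        + (radial (coeffB φ) x y - inner ℝ x y / ‖y‖ * radial (coeffC φ) x y) / ‖y‖
          * (x i * inner ℝ y w + y i * inner ℝ x w)
        - inner ℝ x y / ‖y‖ * (radial (coeffB φ) x y
          - inner ℝ x y / ‖y‖ * radial (coeffC φ) x y) / ‖y‖ ^ 2 * (y i * inner ℝ y w)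
        + radial (coeffC φ) x y * (x i * inner ℝ x w) := by
  have h1 := hφ.gForm_eq hxM hx hy (EuclideanSpace.single i 1) w
  simpa [gForm, Pi.single_apply, EuclideanSpace.inner_single_left,
    EuclideanSpace.inner_single_right, ite_mul, mul_ite, Finset.sum_ite_eq] using h1

theorem Qfun_mul {r s : ℝ} (hr : r ≠ 0) (hD : denomQ φ r s ≠ 0) :
    Qfun φ r s * (2 * r * denomQ φ r s) =
      r * ds (ds φ) r s - dr φ r s + s * ds (dr φ) r s := by
  rw [Qfun]
  change 1 / (2 * r) * (_ / denomQ φ r s) * _ = _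
  field_simp

theorem Pfun_mul {r s : ℝ} (hr : r ≠ 0) (h0 : φ r s ≠ 0) :
    Pfun φ r s * (2 * r * φ r s) = r * ds φ r s + s * dr φ r s
      - 2 * r * Qfun φ r s * (s * φ r s + (r ^ 2 - s ^ 2) * ds φ r s) := by
  rw [Pfun]
  field_simp

/-- The `y`-component of the equation defining the geodesic coefficients. -/
theorem spray_eq_snd {r s : ℝ} (h : SmoothAt φ r s) (hr : r ≠ 0) (h0 : φ r s ≠ 0)
    (hD : denomQ φ r s ≠ 0) :
    coeffA φ r s * Pfun φ r s
        + (coeffB φ r s - s * coeffC φ r s) * (r ^ 2 - s ^ 2) * Qfun φ r s =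
      1 / 2 * (dr (coeffA φ) r s * (s / r) + ds (coeffA φ) r s) := by
  have hQ := Qfun_mul hr hD
  have hP := Pfun_mul (φ := φ) hr h0
  rw [h.ds_dr_comm] at hQ
  rw [dr_coeffA h, dr_coeffB h, ds_coeffA h]
  simp only [coeffA, coeffB, coeffC, denomQ] at *
  field_simp
  -- `φ (φ - s φ_s) = coeffA`, so this multiple of the equation for `P` yields `coeffA * P`; the
  -- equation for `Q` absorbs the remainder.
  linear_combination (φ r s - s * ds φ r s) * hP - s * φ r s * hQ

/-- The `x`-component of the equation defining the geodesic coefficients. -/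
theorem spray_eq_fst {r s : ℝ} (h : SmoothAt φ r s) (hr : r ≠ 0) (h0 : φ r s ≠ 0)
    (hD : denomQ φ r s ≠ 0) :
    coeffA φ r s * Qfun φ r s + coeffB φ r s * Pfun φ r s
        + Qfun φ r s * (s * coeffB φ r s + coeffC φ r s * (r ^ 2 - s ^ 2)) =
      1 / 2 * (dr (coeffB φ) r s * (s / r) + ds (coeffB φ) r s - φ r s * dr φ r s / r) := by
  have hQ := Qfun_mul hr hD
  have hP := Pfun_mul (φ := φ) hr h0
  rw [h.ds_dr_comm] at hQ
  rw [dr_coeffB h, ds_coeffB h]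
  simp only [coeffA, coeffB, coeffC, denomQ] at *
  field_simp
  linear_combination (ds φ r s) * hP + φ r s * hQ

theorem eventually_mem_interior_ne_zero (hxM : x ∈ interior M) (hx : x ≠ 0) :
    ∀ᶠ x' in 𝓝 x, x' ∈ interior M ∧ x' ≠ 0 :=
  (isOpen_interior.eventually_mem hxM).and (isOpen_ne.eventually_mem hx)

/-- The lowered vector `4 g_il Gⁱ` lies in the span of `x` and `y`; comparing the two components
leaves `spray_eq_snd` and `spray_eq_fst`. Interiority allows the formula for `F` to be
differentiated in `x`. -/
theorem IsSphericallySymmetric.geodesicCoeff_eq (hφ : IsSphericallySymmetric M F φ)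
    (hF : IsFinslerMetric M F) (hn : 3 ≤ n) (hxM : x ∈ interior M) (hx : x ≠ 0) (hy : y ≠ 0)
    (i : Fin n) :
    geodesicCoeff F x y i =
      ‖y‖ * radial (Pfun φ) x y * y i + ‖y‖ ^ 2 * radial (Qfun φ) x y * x i := by
  have hxM' := interior_subset hxM
  have hy' : ‖y‖ ≠ 0 := norm_ne_zero_iff.2 hy
  have hx' : ‖x‖ ≠ 0 := norm_ne_zero_iff.2 hx
  have hsm := hφ.smoothAt hxM' hx hy
  have h0 := (hφ.radial_pos hF hxM' hy).ne'
  have hD := hφ.denomQ_ne_zero hF hn hxM' hx hy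
  -- The two terms `2 |y| B y_l`, one from the `δ_kl` part and one from `(F²)_{xˡ}`, cancel.
  have hv : ∀ l, (∑ k, pd k (fun x' => pd l (fun y' => F x' y' ^ 2) y) x * y k)
      - pd l (fun x' => F x' y ^ 2) x =
      2 * ‖y‖ * (radial (dr (coeffA φ)) x y * (inner ℝ x y / ‖y‖ / ‖x‖)
        + radial (ds (coeffA φ)) x y) * y l
      + 2 * ‖y‖ ^ 2 * (radial (dr (coeffB φ)) x y * (inner ℝ x y / ‖y‖ / ‖x‖)
        + radial (ds (coeffB φ)) x y - radial φ x y * radial (dr φ) x y / ‖x‖) * x l := by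
    intro l
    have h1 : ∀ k, pd k (fun x' => pd l (fun y' => F x' y' ^ 2) y) x = _ := fun k =>
      ((hasPd_energy_snd_fst hsm hx k l).congr (g := fun x' => pd l (fun y' => F x' y' ^ 2) y) (by
        filter_upwards [eventually_mem_interior_ne_zero hxM hx] with z hz
        exact (hφ.hasPd_sq_snd (interior_subset hz.1) hz.2 hy l).2) rfl).2
    have h2 : pd l (fun x' => F x' y ^ 2) x = _ :=
      ((hasPd_energy_fst hsm hx hy l).congr (g := fun x' => F x' y ^ 2) (by
        filter_upwards [eventually_mem_interior_ne_zero hxM hx] with z hz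
        rw [hφ.eq z (interior_subset hz.1) y hy, radial]) rfl).2
    rw [h2, Finset.sum_congr rfl fun k _ => congrArg (· * y k) ((h1 k).trans
      (show _ = (2 * radial (dr (coeffA φ)) x y / ‖x‖ * y l
          + 2 * ‖y‖ * radial (dr (coeffB φ)) x y / ‖x‖ * x l) * x k
        + (2 * radial (ds (coeffA φ)) x y / ‖y‖ * y l
          + 2 * radial (ds (coeffB φ)) x y * x l) * y k
        + 2 * ‖y‖ * radial (coeffB φ) x y * (if k = l then 1 else 0) by field_simp; ring)),
      sum_frame_mul, real_inner_self_eq_norm_sq]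
    field_simp
    ring
  rw [geodesicCoeff]
  simp only [hv]
  rw [fundTensor_mulVec_inv hF hxM' hy
    -- The factor 4 offsets the `1/4` in the definition of `geodesicCoeff`.
    (w := ((4 * ‖y‖ * radial (Pfun φ) x y) • y + (4 * ‖y‖ ^ 2 * radial (Qfun φ) x y) • x).ofLp)]
  · simp
    ring
  intro l
  rw [hφ.sum_fundTensor_mul hxM' hx hy]
  have e1 := spray_eq_snd hsm hx' h0 hD
  have e2 := spray_eq_fst hsm hx' h0 hD
  have hyx : inner ℝ y x = inner ℝ x y / ‖y‖ * ‖y‖ := by rw [real_inner_comm]; field_simp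
  have hxy : inner ℝ x y = inner ℝ x y / ‖y‖ * ‖y‖ := by field_simp
  simp only [inner_add_right, real_inner_smul_right, real_inner_self_eq_norm_sq, hyx,
    PiLp.add_apply, PiLp.smul_apply, smul_eq_mul]
  simp only [radial] at *
  generalize hs : inner ℝ x y / ‖y‖ = s at *
  rw [hxy]
  field_simp at e1 e2 ⊢
  linear_combination 2 * y l * e1 + 2 * ‖y‖ * x l * e2

end Metric

/-! ### Riemann curvature of a radial spray, modulo `x_k` and `y_k`. -/

/-- The spray coefficients of `F` over the point `x ≠ 0` are
`Gⁱ = |y| P yⁱ + |y|² Q xⁱ` with smooth functions `P(r,s)` and `Q(r,s)`. -/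
structure HasRadialSpray (F : E n → E n → ℝ) (P Q : ℝ → ℝ → ℝ) (x : E n) : Prop where
  ne_zero : x ≠ 0
  smooth_fst : ∀ y : E n, y ≠ 0 → SmoothAt P ‖x‖ (inner ℝ x y / ‖y‖)
  smooth_snd : ∀ y : E n, y ≠ 0 → SmoothAt Q ‖x‖ (inner ℝ x y / ‖y‖)
  eq : ∀ y : E n, y ≠ 0 → ∀ i,
    geodesicCoeff F x y i = ‖y‖ * radial P x y * y i + ‖y‖ ^ 2 * radial Q x y * x i

/-- The function `c ψ - s ψ_s`. -/
def legendre (c : ℝ) (ψ : ℝ → ℝ → ℝ) (r s : ℝ) : ℝ := c * ψ r s - s * ds ψ r s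

theorem SmoothAt.legendre {ψ : ℝ → ℝ → ℝ} {r s : ℝ} (h : SmoothAt ψ r s) (c : ℝ) :
    SmoothAt (legendre c ψ) r s :=
  ((smoothAt_const c).mul h).sub (smoothAt_snd.mul h.ds)

/-- The nonlinear connection `∂Gⁱ/∂yᵏ` of a radial spray. -/
def radialConn (P Q : ℝ → ℝ → ℝ) (x y : E n) (i k : Fin n) : ℝ :=
  radial (ds P) x y * x k * y i + ‖y‖⁻¹ * radial (legendre 1 P) x y * y k * y i
    + ‖y‖ * radial P x y * (if k = i then 1 else 0)
    + ‖y‖ * radial (ds Q) x y * x k * x i + radial (legendre 2 Q) x y * y k * x i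

theorem sum_mul_ite (c : Fin n → ℝ) (k : Fin n) :
    ∑ j, c j * (if j = k then 1 else 0) = c k := by simp

section Spray

variable {F : E n → E n → ℝ} {P Q : ℝ → ℝ → ℝ} {x y : E n}

/-- The `y_k`-derivative of `|y|^c ψ` is `|y|^(c-2) (c ψ - s ψ_s) y_k + |y|^(c-1) ψ_s x_k`; hence
`legendre` with `c = 1` for `P` and `c = 2` for `Q`. -/
theorem HasRadialSpray.hasPd_snd (h : HasRadialSpray F P Q x) (hy : y ≠ 0) (i k : Fin n) :
    HasPd k (fun y' => geodesicCoeff F x y' i) (radialConn P Q x y i k) y := by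
  have hy' : ‖y‖ ≠ 0 := norm_ne_zero_iff.2 hy
  have h0 := HasPd.norm (i := k) hy
  have h1 := (h0.mul (HasPd.radial_snd (i := k) (h.smooth_fst y hy) hy)).mul (HasPd.coord i)
  have h2 := ((h0.mul h0).mul (HasPd.radial_snd (i := k) (h.smooth_snd y hy) hy)).mul_const (x i)
  refine (h1.add h2).congr ?_ ?_
  · filter_upwards [isOpen_ne.mem_nhds hy] with z hz
    rw [h.eq z hz]
    ring
  · simp only [radialConn, radial, legendre]
    field_simp
    ring

/-- Only the coefficient of `δ_ki` matters later; `α` and `β`, independent of `k`, stay existential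
here and in the lemmas for the other three terms. -/
theorem HasRadialSpray.hasPd_fst (h : ∀ᶠ x' in 𝓝 x, HasRadialSpray F P Q x') (hy : y ≠ 0)
    (i : Fin n) : ∃ α β : ℝ, ∀ k, pd k (fun x' => geodesicCoeff F x' y i) x =
      α * x k + β * y k + ‖y‖ ^ 2 * radial Q x y * (if k = i then 1 else 0) := by
  have hx := h.self_of_nhds
  refine ⟨(‖y‖ * radial (dr P) x y * y i + ‖y‖ ^ 2 * radial (dr Q) x y * x i) / ‖x‖,
    (‖y‖ * radial (ds P) x y * y i + ‖y‖ ^ 2 * radial (ds Q) x y * x i) / ‖y‖, fun k => ?_⟩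
  have h1 := ((HasPd.radial_fst (i := k) (hx.smooth_fst y hy) hx.ne_zero).const_mul ‖y‖).mul_const
    (y i)
  have h2 := ((HasPd.radial_fst (i := k) (hx.smooth_snd y hy) hx.ne_zero).const_mul
    (‖y‖ ^ 2)).mul (HasPd.coord i)
  refine ((h1.add h2).congr ?_ ?_).2
  · filter_upwards [h] with z hz using hz.eq y hy i
  · ring

/-- The `δ_ki` coefficient is the `x`-derivative of `|y| P` in the direction `y`, coming from the
term `|y| P δ_ki` of `radialConn`. -/
theorem HasRadialSpray.sum_pd_snd_fst (h : ∀ᶠ x' in 𝓝 x, HasRadialSpray F P Q x') (hy : y ≠ 0)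
    (i : Fin n) : ∃ α β : ℝ, ∀ k,
      ∑ j, y j * pd j (fun x' => pd k (fun y' => geodesicCoeff F x' y' i) y) x =
      α * x k + β * y k + ‖y‖ ^ 2 * (inner ℝ x y / ‖y‖ / ‖x‖ * radial (dr P) x y
        + radial (ds P) x y) * (if k = i then 1 else 0) := by
  have hx := h.self_of_nhds
  have hx0 := hx.ne_zero
  have hy' : ‖y‖ ≠ 0 := norm_ne_zero_iff.2 hy
  have hP := hx.smooth_fst y hy
  have hQ := hx.smooth_snd y hy
  -- The values of these derivatives enter only `α` and `β`, so they are left abstract.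
  obtain ⟨a, ha⟩ : ∃ a : Fin n → ℝ, ∀ j, HasPd j (fun x' => radial (ds P) x' y) (a j) x :=
    ⟨_, fun j => HasPd.radial_fst hP.ds hx0⟩
  obtain ⟨b, hb⟩ : ∃ b : Fin n → ℝ, ∀ j,
      HasPd j (fun x' => ‖y‖⁻¹ * radial (legendre 1 P) x' y) (b j) x :=
    ⟨_, fun j => (HasPd.radial_fst (hP.legendre 1) hx0).const_mul _⟩
  obtain ⟨a', ha'⟩ : ∃ a : Fin n → ℝ, ∀ j, HasPd j (fun x' => ‖y‖ * radial (ds Q) x' y) (a j) x :=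
    ⟨_, fun j => (HasPd.radial_fst hQ.ds hx0).const_mul _⟩
  obtain ⟨b', hb'⟩ : ∃ b : Fin n → ℝ, ∀ j,
      HasPd j (fun x' => radial (legendre 2 Q) x' y) (b j) x :=
    ⟨_, fun j => HasPd.radial_fst (hQ.legendre 2) hx0⟩
  have hp := fun j => (HasPd.radial_fst (i := j) hP hx0).const_mul ‖y‖
  have hsum : ∑ j, y j * (‖y‖ * (radial (dr P) x y * (x j / ‖x‖) + radial (ds P) x y
      * (y j / ‖y‖))) = ‖y‖ ^ 2 * (inner ℝ x y / ‖y‖ / ‖x‖ * radial (dr P) x y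
        + radial (ds P) x y) := by
    have h1 : ∀ j, y j * (‖y‖ * (radial (dr P) x y * (x j / ‖x‖) + radial (ds P) x y
        * (y j / ‖y‖))) = (x j * y j) * (‖y‖ * radial (dr P) x y / ‖x‖)
          + (y j * y j) * radial (ds P) x y := fun j => by field_simp
    simp only [h1, Finset.sum_add_distrib, ← Finset.sum_mul, sum_coord_mul_coord x y,
      sum_coord_mul_self]
    field_simp
  rw [← hsum]
  set p : Fin n → ℝ := fun j => ‖y‖ * (radial (dr P) x y * (x j / ‖x‖) + radial (ds P) x y
      * (y j / ‖y‖))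
  have key : ∀ j k, y j * pd j (fun x' => pd k (fun y' => geodesicCoeff F x' y' i) y) x =
      (y j * a j) * (x k * y i) + (y j * (if j = k then 1 else 0)) * (radial (ds P) x y * y i)
      + (y j * b j) * (y k * y i) + (y j * p j) * (if k = i then 1 else 0)
      + (y j * a' j) * (x k * x i)
      + (y j * (if j = k then 1 else 0)) * (‖y‖ * radial (ds Q) x y * x i)
      + (y j * (if j = i then 1 else 0)) * (‖y‖ * radial (ds Q) x y * x k)
      + (y j * b' j) * (y k * x i)
      + (y j * (if j = i then 1 else 0)) * (radial (legendre 2 Q) x y * y k) := by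
    intro j k
    have h1 := (((((ha j).mul (HasPd.coord k)).mul_const (y i)).add
      (((hb j).mul_const (y k)).mul_const (y i))).add
      ((hp j).mul_const (if k = i then 1 else 0))).add
      (((ha' j).mul (HasPd.coord k)).mul (HasPd.coord i)) |>.add
      (((hb' j).mul_const (y k)).mul (HasPd.coord i))
    rw [(h1.congr (g := fun x' => pd k (fun y' => geodesicCoeff F x' y' i) y) (by
      filter_upwards [h] with z hz using (hz.hasPd_snd hy i k).2) rfl).2]
    ring
  refine ⟨(∑ j, y j * a j) * y i + (∑ j, y j * a' j) * x i + y i * (‖y‖ * radial (ds Q) x y),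
    radial (ds P) x y * y i + (∑ j, y j * b j) * y i + ‖y‖ * radial (ds Q) x y * x i
      + (∑ j, y j * b' j) * x i + y i * radial (legendre 2 Q) x y, fun k => ?_⟩
  simp only [key, Finset.sum_add_distrib, ← Finset.sum_mul, sum_mul_ite (fun j => y j)]
  ring

/-- Here the `δ_ki` coefficient is the `y`-derivative of `|y| P` in the direction `G`, evaluated
through `⟨G,x⟩` and `⟨G,y⟩`. -/
theorem HasRadialSpray.sum_pd_snd_snd (hx : HasRadialSpray F P Q x) (hy : y ≠ 0)
    (i : Fin n) : ∃ α β : ℝ, ∀ k,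
      ∑ j, geodesicCoeff F x y j *
        pd j (fun y' => pd k (fun y'' => geodesicCoeff F x y'' i) y') y =
      α * x k + β * y k + ‖y‖ ^ 2 * (radial P x y ^ 2
        + inner ℝ x y / ‖y‖ * radial P x y * radial Q x y
        + (‖x‖ ^ 2 - (inner ℝ x y / ‖y‖) ^ 2) * radial Q x y * radial (ds P) x y)
          * (if k = i then 1 else 0) := by
  have hy' : ‖y‖ ≠ 0 := norm_ne_zero_iff.2 hy
  have hP := hx.smooth_fst y hy
  have hQ := hx.smooth_snd y hy
  have hnorm := fun j : Fin n => HasPd.norm (i := j) hy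
  obtain ⟨a, ha⟩ : ∃ a : Fin n → ℝ, ∀ j, HasPd j (fun y' => radial (ds P) x y') (a j) y :=
    ⟨_, fun j => HasPd.radial_snd hP.ds hy⟩
  obtain ⟨b, hb⟩ : ∃ b : Fin n → ℝ, ∀ j,
      HasPd j (fun y' => ‖y'‖⁻¹ * radial (legendre 1 P) x y') (b j) y :=
    ⟨_, fun j => ((hnorm j).inv hy').mul (HasPd.radial_snd (hP.legendre 1) hy)⟩
  obtain ⟨a', ha'⟩ : ∃ a : Fin n → ℝ, ∀ j, HasPd j (fun y' => ‖y'‖ * radial (ds Q) x y') (a j) y :=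
    ⟨_, fun j => (hnorm j).mul (HasPd.radial_snd hQ.ds hy)⟩
  obtain ⟨b', hb'⟩ : ∃ b : Fin n → ℝ, ∀ j,
      HasPd j (fun y' => radial (legendre 2 Q) x y') (b j) y :=
    ⟨_, fun j => HasPd.radial_snd (hQ.legendre 2) hy⟩
  have hp := fun j => (hnorm j).mul (HasPd.radial_snd (i := j) hP hy)
  set p : Fin n → ℝ := fun j => y j / ‖y‖ * radial P x y + ‖y‖ * (radial (ds P) x y *
    (x j / ‖y‖ - inner ℝ x y / ‖y‖ * y j / ‖y‖ ^ 2)) with hpdef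
  set g : Fin n → ℝ := fun j => geodesicCoeff F x y j with hg
  have hgx : ∑ j, g j * x j = ‖y‖ ^ 2 * (inner ℝ x y / ‖y‖ * radial P x y
      + ‖x‖ ^ 2 * radial Q x y) := by
    have h1 : ∀ j, g j * x j = (x j * y j) * (‖y‖ * radial P x y)
      + (x j * x j) * (‖y‖ ^ 2 * radial Q x y) := fun j => by rw [hg]; simp only [hx.eq y hy]; ring
    simp only [h1, Finset.sum_add_distrib, ← Finset.sum_mul, sum_coord_mul_coord x y,
      sum_coord_mul_self]
    field_simp
  have hgy : ∑ j, g j * y j = ‖y‖ ^ 3 * (radial P x y + inner ℝ x y / ‖y‖ * radial Q x y) := by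
    have h1 : ∀ j, g j * y j = (y j * y j) * (‖y‖ * radial P x y)
      + (x j * y j) * (‖y‖ ^ 2 * radial Q x y) := fun j => by rw [hg]; simp only [hx.eq y hy]; ring
    simp only [h1, Finset.sum_add_distrib, ← Finset.sum_mul, sum_coord_mul_coord x y,
      sum_coord_mul_self]
    field_simp
  have hgp : ∑ j, g j * p j = ‖y‖ ^ 2 * (radial P x y ^ 2
        + inner ℝ x y / ‖y‖ * radial P x y * radial Q x y
        + (‖x‖ ^ 2 - (inner ℝ x y / ‖y‖) ^ 2) * radial Q x y * radial (ds P) x y) := by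
    have h1 : ∀ j, g j * p j = (g j * x j) * radial (ds P) x y
        + (g j * y j) * ((radial P x y - inner ℝ x y / ‖y‖ * radial (ds P) x y) / ‖y‖) := by
      intro j
      rw [hpdef]
      field_simp
      ring
    simp only [h1, Finset.sum_add_distrib, ← Finset.sum_mul, hgx, hgy]
    field_simp
    ring
  rw [← hgp]
  have key : ∀ j k, g j * pd j (fun y' => pd k (fun y'' => geodesicCoeff F x y'' i) y') y =
      (g j * a j) * (x k * y i) + (g j * (if j = i then 1 else 0)) * (radial (ds P) x y * x k)
      + (g j * b j) * (y k * y i)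
      + (g j * (if j = k then 1 else 0)) * (‖y‖⁻¹ * radial (legendre 1 P) x y * y i)
      + (g j * (if j = i then 1 else 0)) * (‖y‖⁻¹ * radial (legendre 1 P) x y * y k)
      + (g j * p j) * (if k = i then 1 else 0)
      + (g j * a' j) * (x k * x i)
      + (g j * b' j) * (y k * x i)
      + (g j * (if j = k then 1 else 0)) * (radial (legendre 2 Q) x y * x i) := by
    intro j k
    have h1 := (((((ha j).mul_const (x k)).mul (HasPd.coord i)).add
      (((hb j).mul (HasPd.coord k)).mul (HasPd.coord i))).add
      ((hp j).mul_const (if k = i then 1 else 0))).add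
      (((ha' j).mul_const (x k)).mul_const (x i)) |>.add
      (((hb' j).mul (HasPd.coord k)).mul_const (x i))
    rw [(h1.congr (g := fun y' => pd k (fun y'' => geodesicCoeff F x y'' i) y') (by
      filter_upwards [isOpen_ne.mem_nhds hy] with z hz using (hx.hasPd_snd hz i k).2) rfl).2]
    ring
  refine ⟨(∑ j, g j * a j) * y i + g i * radial (ds P) x y + (∑ j, g j * a' j) * x i
      + ‖y‖ ^ 2 * radial Q x y * (‖y‖⁻¹ * radial (legendre 1 P) x y * y i
        + radial (legendre 2 Q) x y * x i),
    (∑ j, g j * b j) * y i + g i * (‖y‖⁻¹ * radial (legendre 1 P) x y)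
      + (∑ j, g j * b' j) * x i
      + ‖y‖ * radial P x y * (‖y‖⁻¹ * radial (legendre 1 P) x y * y i
        + radial (legendre 2 Q) x y * x i), fun k => ?_⟩
  change ∑ j, g j * _ = _
  simp only [key, Finset.sum_add_distrib, ← Finset.sum_mul, sum_mul_ite g]
  rw [show g k = _ from hx.eq y hy k]
  ring

/-- The connection is `|y| P` times the identity plus terms carrying `x_k` or `y_k`, so only the
square of its scalar part survives. -/
theorem HasRadialSpray.sum_pd_mul_pd (hx : HasRadialSpray F P Q x) (hy : y ≠ 0)
    (i : Fin n) : ∃ α β : ℝ, ∀ k,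
      ∑ j, pd j (fun y' => geodesicCoeff F x y' i) y * pd k (fun y' => geodesicCoeff F x y' j) y =
      α * x k + β * y k + ‖y‖ ^ 2 * radial P x y ^ 2 * (if k = i then 1 else 0) := by
  set N : Fin n → ℝ := fun j => radialConn P Q x y i j with hN
  have key : ∀ j k, pd j (fun y' => geodesicCoeff F x y' i) y *
      pd k (fun y' => geodesicCoeff F x y' j) y =
      (N j * y j) * (radial (ds P) x y * x k + ‖y‖⁻¹ * radial (legendre 1 P) x y * y k)
      + (N j * (if j = k then 1 else 0)) * (‖y‖ * radial P x y)
      + (N j * x j) * (‖y‖ * radial (ds Q) x y * x k + radial (legendre 2 Q) x y * y k) := by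
    intro j k
    rw [(hx.hasPd_snd hy i j).2, (hx.hasPd_snd hy j k).2]
    simp only [hN, radialConn, eq_comm (a := k) (b := j)]
    ring
  refine ⟨(∑ j, N j * y j) * radial (ds P) x y + (∑ j, N j * x j) * (‖y‖ * radial (ds Q) x y)
      + ‖y‖ * radial P x y * (radial (ds P) x y * y i + ‖y‖ * radial (ds Q) x y * x i),
    (∑ j, N j * y j) * (‖y‖⁻¹ * radial (legendre 1 P) x y)
      + (∑ j, N j * x j) * radial (legendre 2 Q) x y
      + ‖y‖ * radial P x y * (‖y‖⁻¹ * radial (legendre 1 P) x y * y i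
        + radial (legendre 2 Q) x y * x i), fun k => ?_⟩
  simp only [key, Finset.sum_add_distrib, ← Finset.sum_mul, sum_mul_ite N]
  simp only [hN, radialConn]
  ring

theorem HasRadialSpray.riemann_eq (h : ∀ᶠ x' in 𝓝 x, HasRadialSpray F P Q x') (hy : y ≠ 0)
    (i : Fin n) : ∃ α β : ℝ, ∀ k, riemann F x y i k =
      α * x k + β * y k + ‖y‖ ^ 2 * radial (R₁ P Q) x y * (if k = i then 1 else 0) := by
  have hx := h.self_of_nhds
  have hx' : ‖x‖ ≠ 0 := norm_ne_zero_iff.2 hx.ne_zero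
  obtain ⟨α₁, β₁, h1⟩ := HasRadialSpray.hasPd_fst h hy i
  obtain ⟨α₂, β₂, h2⟩ := HasRadialSpray.sum_pd_snd_fst h hy i
  obtain ⟨α₃, β₃, h3⟩ := hx.sum_pd_snd_snd hy i
  obtain ⟨α₄, β₄, h4⟩ := hx.sum_pd_mul_pd hy i
  refine ⟨2 * α₁ - α₂ + 2 * α₃ - α₄, 2 * β₁ - β₂ + 2 * β₃ - β₄, fun k => ?_⟩
  rw [riemann, h1, h2, h3, h4]
  simp only [radial, R₁]
  field_simp
  ring

theorem HasRadialSpray.riemannMap_eq (h : ∀ᶠ x' in 𝓝 x, HasRadialSpray F P Q x') (hy : y ≠ 0)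
    {u : E n} (hxu : inner ℝ x u = 0) (hyu : inner ℝ y u = 0) :
    riemannMap F x y u = (‖y‖ ^ 2 * radial (R₁ P Q) x y) • u := by
  ext i
  obtain ⟨α, β, h1⟩ := HasRadialSpray.riemann_eq h hy i
  simp only [riemannMap, h1, sum_frame_mul, hxu, hyu, PiLp.smul_apply, smul_eq_mul]
  ring

end Spray

/-! ### Flag curvature at interior points. -/

section Metric

variable {M : Set (E n)} {F : E n → E n → ℝ} {φ : ℝ → ℝ → ℝ} {x y : E n} {K : ℝ}

theorem IsSphericallySymmetric.smoothAt_Qfun (hφ : IsSphericallySymmetric M F φ)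
    (hF : IsFinslerMetric M F) (hn : 3 ≤ n) (hxM : x ∈ M) (hx : x ≠ 0) (hy : y ≠ 0) :
    SmoothAt (Qfun φ) ‖x‖ (inner ℝ x y / ‖y‖) := by
  have h := hφ.smoothAt hxM hx hy
  have hx' : ‖x‖ ≠ 0 := norm_ne_zero_iff.2 hx
  exact ((smoothAt_const 1).div ((smoothAt_const 2).mul smoothAt_fst) (by positivity)).mul
    ((((smoothAt_fst.mul h.ds.ds).sub h.dr).add (smoothAt_snd.mul h.dr.ds)).div
      ((h.sub (smoothAt_snd.mul h.ds)).add
        (((smoothAt_fst.pow 2).sub (smoothAt_snd.pow 2)).mul h.ds.ds))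
      (hφ.denomQ_ne_zero hF hn hxM hx hy))

theorem IsSphericallySymmetric.smoothAt_Pfun (hφ : IsSphericallySymmetric M F φ)
    (hF : IsFinslerMetric M F) (hn : 3 ≤ n) (hxM : x ∈ M) (hx : x ≠ 0) (hy : y ≠ 0) :
    SmoothAt (Pfun φ) ‖x‖ (inner ℝ x y / ‖y‖) := by
  have h := hφ.smoothAt hxM hx hy
  have hx' : ‖x‖ ≠ 0 := norm_ne_zero_iff.2 hx
  have h0 : φ ‖x‖ (inner ℝ x y / ‖y‖) ≠ 0 := (hφ.radial_pos hF hxM hy).ne'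
  exact (((smoothAt_fst.mul h.ds).add (smoothAt_snd.mul h.dr)).div
      (((smoothAt_const 2).mul smoothAt_fst).mul h) (by positivity)).sub
    (((hφ.smoothAt_Qfun hF hn hxM hx hy).div h h0).mul ((smoothAt_snd.mul h).add
        (((smoothAt_fst.pow 2).sub (smoothAt_snd.pow 2)).mul h.ds)))

theorem SmoothAt.R₁ {P Q : ℝ → ℝ → ℝ} {r s : ℝ} (hP : SmoothAt P r s) (hQ : SmoothAt Q r s)
    (hr : r ≠ 0) : SmoothAt (R₁ P Q) r s :=
  ((hP.pow 2).sub (((smoothAt_const 1).div smoothAt_fst hr).mul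
    ((smoothAt_snd.mul hP.dr).add (smoothAt_fst.mul hP.ds)))).add
    (((smoothAt_const 2).mul hQ).mul (((smoothAt_const 1).add (smoothAt_snd.mul hP)).add
      (((smoothAt_fst.pow 2).sub (smoothAt_snd.pow 2)).mul hP.ds)))

theorem IsSphericallySymmetric.eventually_hasRadialSpray (hφ : IsSphericallySymmetric M F φ)
    (hF : IsFinslerMetric M F) (hn : 3 ≤ n) (hxM : x ∈ interior M) (hx : x ≠ 0) :
    ∀ᶠ x' in 𝓝 x, HasRadialSpray F (Pfun φ) (Qfun φ) x' := by
  filter_upwards [eventually_mem_interior_ne_zero hxM hx] with z hz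
  exact ⟨hz.2, fun y hy => hφ.smoothAt_Pfun hF hn (interior_subset hz.1) hz.2 hy,
    fun y hy => hφ.smoothAt_Qfun hF hn (interior_subset hz.1) hz.2 hy,
    fun y hy i => hφ.geodesicCoeff_eq hF hn hz.1 hz.2 hy i⟩

theorem linearIndependent_of_orthogonal {u : E n} (hy : y ≠ 0) (hu : u ≠ 0)
    (h : inner ℝ y u = 0) : LinearIndependent ℝ ![y, u] := by
  refine linearIndependent_of_ne_zero_of_inner_eq_zero (𝕜 := ℝ) (fun i => ?_) fun i j hij => ?_
  · fin_cases i <;> assumption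
  · have h' : inner ℝ u y = 0 := by rw [real_inner_comm, h]
    fin_cases i <;> fin_cases j <;> simp_all

theorem IsSphericallySymmetric.eq_of_mem_interior (hφ : IsSphericallySymmetric M F φ)
    (hF : IsFinslerMetric M F) (hK : HasConstantFlagCurvature M F K) (hn : 3 ≤ n)
    (hxM : x ∈ interior M) (hx : x ≠ 0) (hy : y ≠ 0) :
    K = radial (R₁ (Pfun φ) (Qfun φ)) x y / radial φ x y ^ 2 := by
  have hxM' := interior_subset hxM
  have hy' : ‖y‖ ≠ 0 := norm_ne_zero_iff.2 hy
  have h0 := (hφ.radial_pos hF hxM' hy).ne'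
  have hA := (hφ.coeffA_pos hF hn hxM' hx hy).ne'
  obtain ⟨u, hu, hxu, hyu⟩ := exists_ne_zero_orthogonal hn x y
  have huu : inner ℝ u u ≠ 0 := inner_self_ne_zero.2 hu
  have hyy : gForm F x y y y = ‖y‖ ^ 2 * radial φ x y ^ 2 := by
    rw [hφ.gForm_eq hxM' hx hy]
    simp only [real_inner_self_eq_norm_sq, radial, coeffA, coeffB, coeffC]
    field_simp
    ring
  rw [← hK x hxM' y u (linearIndependent_of_orthogonal hy hu hyu), flagCurvature,
    HasRadialSpray.riemannMap_eq (hφ.eventually_hasRadialSpray hF hn hxM hx) hy hxu hyu, hyy]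
  simp only [hφ.gForm_orthogonal hxM' hx hy hxu hyu, hyu, real_inner_smul_left]
  -- Numerator and denominator share the factor `|y|² coeffA ⟨u,u⟩`.
  field_simp
  simp only [real_inner_self_eq_norm_sq]
  ring

/-! ### Passage to the inner boundary sphere. -/

/-- A point of a symmetric domain is a radial limit of interior points. -/
theorem IsSymmetricDomain.eventually_smul_mem_interior (hM : IsSymmetricDomain M) (hxM : x ∈ M)
    (hx : x ≠ 0) : ∀ᶠ t : ℝ in 𝓝[>] 1, t • x ∈ interior M := by
  have hcont : Tendsto (fun t : ℝ => t • x) (𝓝[>] 1) (𝓝 x) := by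
    have : ContinuousAt (fun t : ℝ => t • x) 1 := by fun_prop
    simpa using this.tendsto.mono_left nhdsWithin_le_nhds
  have hopen : IsOpen M → ∀ᶠ t : ℝ in 𝓝[>] 1, t • x ∈ interior M := fun h => by
    rw [h.interior_eq]
    exact hcont.eventually (h.eventually_mem hxM)
  rcases hM with ⟨ν, -, rfl⟩ | ⟨ν₁, ν₂, -, -, rfl | rfl⟩ | rfl | rfl
  · exact hopen Metric.isOpen_ball
  -- The half-closed annulus is the one case not settled by openness: for `t > 1`, `ν₂ ≤ |x| < t
  -- |x|` puts `t • x` strictly outside the inner sphere.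
  · have hsub : Metric.ball (0 : E n) ν₁ \ Metric.closedBall 0 ν₂ ⊆
        interior (Metric.ball 0 ν₁ \ Metric.ball 0 ν₂) :=
      interior_maximal (Set.sdiff_subset_sdiff_right Metric.ball_subset_closedBall)
        (Metric.isOpen_ball.sdiff Metric.isClosed_closedBall)
    filter_upwards [hcont.eventually (Metric.isOpen_ball.eventually_mem hxM.1),
      self_mem_nhdsWithin] with t ht ht1
    refine hsub ⟨ht, ?_⟩
    have h1 : ν₂ ≤ ‖x‖ := by simpa using hxM.2
    have h2 : 0 < ‖x‖ := norm_pos_iff.2 hx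
    have h3 : (1 : ℝ) < t := ht1
    rw [mem_closedBall_zero_iff, not_le, norm_smul, Real.norm_of_nonneg (by linarith)]
    nlinarith
  · exact hopen (Metric.isOpen_ball.sdiff Metric.isClosed_closedBall)
  · exact hopen isOpen_univ
  · exact hopen (isOpen_univ.sdiff isClosed_singleton)

theorem SmoothAt.tendsto_radial_smul {ψ : ℝ → ℝ → ℝ}
    (h : SmoothAt ψ ‖x‖ (inner ℝ x y / ‖y‖)) :
    Tendsto (fun t : ℝ => radial ψ (t • x) y) (𝓝[>] 1) (𝓝 (radial ψ x y)) := by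
  have h1 : Tendsto (fun t : ℝ => (‖t • x‖, inner ℝ (t • x) y / ‖y‖)) (𝓝 1)
      (𝓝 (‖x‖, inner ℝ x y / ‖y‖)) := by
    have : ContinuousAt (fun t : ℝ => (‖t • x‖, inner ℝ (t • x) y / ‖y‖)) 1 := by
      simp only [div_eq_mul_inv]
      fun_prop
    simpa using this.tendsto
  exact (h.differentiableAt.continuousAt.tendsto.comp h1).mono_left nhdsWithin_le_nhds

end Metric

end

end SphFinsler

theorem theorem4 (n : ℕ) (hn : 3 ≤ n) (M : Set (SphFinsler.E n))
    (hM : SphFinsler.IsSymmetricDomain M)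
    (F : SphFinsler.E n → SphFinsler.E n → ℝ) (φ : ℝ → ℝ → ℝ) (K : ℝ)
    (hF : SphFinsler.IsFinslerMetric M F)
    (hφ : SphFinsler.IsSphericallySymmetric M F φ)
    (hD : SphFinsler.IsDouglas M F)
    (hK : SphFinsler.HasConstantFlagCurvature M F K) :
    ∀ x ∈ M, x ≠ 0 → ∀ y : SphFinsler.E n, y ≠ 0 →
      K = SphFinsler.R₁ (SphFinsler.Pfun φ) (SphFinsler.Qfun φ) ‖x‖ (inner ℝ x y / ‖y‖) /
        φ ‖x‖ (inner ℝ x y / ‖y‖) ^ 2 := by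
  intro x hxM hx y hy
  have hR := SphFinsler.SmoothAt.R₁ (hφ.smoothAt_Pfun hF hn hxM hx hy)
    (hφ.smoothAt_Qfun hF hn hxM hx hy) (norm_ne_zero_iff.2 hx)
  have h0 := pow_ne_zero 2 (hφ.radial_pos hF hxM hy).ne'
  -- The constant `K` agrees with the quotient at `t • x` for `t > 1` near 1, so it equals the limit
  -- of the quotient at `x`.
  refine tendsto_nhds_unique (tendsto_const_nhds.congr' ?_) (hR.tendsto_radial_smul.div
    ((hφ.smoothAt hxM hx hy).tendsto_radial_smul.pow 2) h0)
  filter_upwards [hM.eventually_smul_mem_interior hxM hx, self_mem_nhdsWithin] with t ht ht1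
  have ht0 : t ≠ 0 := (zero_lt_one.trans (show (1 : ℝ) < t from ht1)).ne'
  exact hφ.eq_of_mem_interior hF hK hn ht (smul_ne_zero ht0 hx) hy
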